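/- **Lemma 2.2.** Let $E$ be a reflexive Banach space (real or complex), let $r>0$, write $B_E(0,\rho)=\{v\in E:\|v\|_E<\rho\}$, and let $\Phi:B_E(0,r)\to E$ be a mapping such that (a1) $\Phi(0)=0$ and $\Phi$ is Fréchet differentiable at $0$ with derivative the identity, i.e. $\|\Phi(v)-v\|_E=o(\|v\|_E)$ as $\|v\|_E\to 0$; (a2) $\Phi$ is weakly sequentially continuous: whenever $v_n, v\in B_E(0,r)$ and $v_n\to v$ weakly in $E$, then $\Phi(v_n)\to\Phi(v)$ weakly in $E$. Then $\Phi$ is a local surjection at $0$: there is $\delta>0$ such that $\Phi(B_E(0,r))\supset B_E(0,\delta)$. -/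

import Mathlib

open Filter Topology Asymptotics

/-- A normed space is reflexive if the canonical embedding into its (topological) bidual
is onto. -/
def IsReflexiveSpace (𝕜 E : Type*) [RCLike 𝕜] [NormedAddCommGroup E] [NormedSpace 𝕜 E] : Prop :=
  Function.Surjective (NormedSpace.inclusionInDoubleDual 𝕜 E)

/-- `u n → a` in the weak topology of `E`. -/
def WeaklyTendsto (𝕜 : Type*) {E : Type*} [RCLike 𝕜] [NormedAddCommGroup E] [NormedSpace 𝕜 E]
    (u : ℕ → E) (a : E) : Prop :=
  Tendsto (fun n => toWeakSpace 𝕜 E (u n)) atTop (𝓝 (toWeakSpace 𝕜 E a))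

/-- `Φ` restricted to `s` is weakly sequentially continuous: for `u n` and `a` in `s`,
`u n → a` weakly implies `Φ (u n) → Φ a` weakly. -/
def WeaklySeqContinuousOn (𝕜 : Type*) {E : Type*} [RCLike 𝕜] [NormedAddCommGroup E]
    [NormedSpace 𝕜 E] (Φ : E → E) (s : Set E) : Prop :=
  ∀ (u : ℕ → E) (a : E), (∀ n, u n ∈ s) → a ∈ s →
    WeaklyTendsto 𝕜 u a → WeaklyTendsto 𝕜 (fun n => Φ (u n)) (Φ a)

/-!
On a small closed ball of radius `ρ < r` the map `v ↦ Φ v - v` has norm at most `‖v‖ / 2`, so for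
`‖w‖ < ρ / 2` the map `g v = v - Φ v + w` sends this ball into itself; `Φ v = w` means that `v` is a
fixed point of `g`. Such a fixed point exists because `g` is weakly sequentially continuous and the
ball is weakly compact (`exists_fixedPoint_of_weaklySeqContinuousOn`).

The fixed point theorem is reduced to finite dimensions in the manner of Schauder. For finitely many
functionals `φ i`, Brouwer's theorem on a simplex gives a point `v` at which all
`φ i (g v) - φ i v` are as small as desired (`exists_approx_fixedPoint`). To pass to the limit along
a sequence, one works in a closed subspace that is invariant under `g` and has a countable dense
subset (`exists_submodule_eq_closure_countable`): there countably many functionals separate points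
(`exists_seq_dual_separating`), and bounded sequences have weakly convergent subsequences
(`exists_subseq_weaklyTendsto`). This avoids the Eberlein-Šmulian theorem, which would otherwise be
needed to turn weak sequential continuity into weak continuity.

Brouwer's theorem is proved analytically, following Milnor and Rogers: a `C¹` retraction `f` of the
ball onto the sphere cannot exist, since the integral of `det (1 + t • (f - id)')` over the ball is
a polynomial in `t` that equals the volume of the ball for small `t > 0` and vanishes for `t = 1`
(`not_contDiffOn_retraction_sphere`). The continuous case follows by smooth approximation, and the
case of a simplex by a retraction of the whole space onto it.
-/

/-! ### Absence of smooth retractions of the ball onto the sphere -/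

section Brouwer

open Metric MeasureTheory Polynomial

variable {V : Type*} [NormedAddCommGroup V] [InnerProductSpace ℝ V] [FiniteDimensional ℝ V]

lemma exists_polynomial_det_one_add_smul (A : V →L[ℝ] V) :
    ∃ p : ℝ[X], p.natDegree ≤ Module.finrank ℝ V ∧
      ∀ t : ℝ, p.eval t = (1 + t • A : V →L[ℝ] V).det := by
  classical
  let b := Module.finBasis ℝ V
  let M := LinearMap.toMatrix b b (A : V →ₗ[ℝ] V)
  refine ⟨((X : ℝ[X]) • M.map C + (1 : Matrix _ _ ℝ).map C).det, ?_, fun t => ?_⟩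
  · simpa using natDegree_det_X_add_C_le M (1 : Matrix _ _ ℝ)
  · have h1 : (1 + t • A : V →L[ℝ] V).det = (1 + t • M).det := by
      rw [ContinuousLinearMap.det, ← LinearMap.det_toMatrix b]
      congr 1
      simp [M, LinearMap.toMatrix_one]
    rw [h1, ← coe_evalRingHom, RingHom.map_det]
    congr 1
    ext i j
    by_cases hij : i = j <;> simp [hij] <;> ring

/-- A map with invertible derivatives that fixes the unit sphere and maps the open unit ball into
itself maps that ball onto itself: the image is open and relatively closed. -/
lemma image_ball_eq_of_det_ne_zero {F : V → V} {F' : V → V →L[ℝ] V}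
    (hF' : ∀ x ∈ closedBall (0 : V) 1, HasStrictFDerivAt F (F' x) x)
    (hdet : ∀ x ∈ closedBall (0 : V) 1, (F' x).det ≠ 0)
    (hmaps : Set.MapsTo F (ball 0 1) (ball 0 1)) (hid : ∀ x, ‖x‖ = 1 → F x = x) :
    F '' ball 0 1 = ball 0 1 := by
  refine hmaps.image_subset.antisymm ?_
  refine (convex_ball (0 : V) 1).isPreconnected.subset_of_closure_inter_subset ?_ ?_ ?_
  · rw [isOpen_iff_mem_nhds]
    rintro _ ⟨x, hx, rfl⟩
    have hx' := ball_subset_closedBall hx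
    have hsurj : (F' x).range = ⊤ := by
      have := (LinearMap.isUnit_iff_isUnit_det (F' x : V →ₗ[ℝ] V)).2
        (isUnit_iff_ne_zero.2 (hdet x hx'))
      exact (LinearMap.isUnit_iff_range_eq_top _).1 this
    rw [← (hF' x hx').map_nhds_eq_of_surj hsurj]
    exact image_mem_map (isOpen_ball.mem_nhds hx)
  · exact ⟨F 0, hmaps (by simp), 0, by simp, rfl⟩
  · rintro y ⟨hy, hyb⟩
    have hcl : IsClosed (F '' closedBall 0 1) :=
      ((isCompact_closedBall (0 : V) 1).image_of_continuousOn
        fun x hx => (hF' x hx).continuousAt.continuousWithinAt).isClosed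
    obtain ⟨x, hx, rfl⟩ := closure_minimal (Set.image_mono ball_subset_closedBall) hcl hy
    refine ⟨x, ?_, rfl⟩
    rw [mem_closedBall_zero_iff] at hx
    rcases hx.lt_or_eq with h | h
    · simpa using h
    · rw [hid x h, mem_ball_zero_iff, h] at hyb
      exact absurd hyb (lt_irrefl _)

variable [MeasurableSpace V] [BorelSpace V]

/-- Each `det (1 + t • A x)` is a polynomial in `t` of degree at most `dim V`, hence a fixed
combination of its values at `0, 1, …, dim V`; so its integral is again a polynomial in `t`. -/
lemma exists_polynomial_integral_det_one_add_smul {A : V → V →L[ℝ] V} {s K : Set V}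
    (hK : IsCompact K) (hsK : s ⊆ K) (hA : ContinuousOn A K) :
    ∃ P : ℝ[X], ∀ t : ℝ, ∫ x in s, (1 + t • A x : V →L[ℝ] V).det = P.eval t := by
  classical
  set n := Module.finrank ℝ V
  have hint : ∀ t : ℝ, IntegrableOn (fun x => (1 + t • A x : V →L[ℝ] V).det) s := fun t =>
    ((ContinuousLinearMap.continuous_det.comp_continuousOn
      (continuousOn_const.add (hA.const_smul t))).integrableOn_compact hK).mono_set hsK
  let v : ℕ → ℝ := fun i => i
  refine ⟨∑ i ∈ Finset.range (n + 1),
    C (∫ x in s, (1 + (i : ℝ) • A x : V →L[ℝ] V).det) *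
      Lagrange.basis (Finset.range (n + 1)) v i, fun t => ?_⟩
  have key : ∀ x, (1 + t • A x : V →L[ℝ] V).det = ∑ i ∈ Finset.range (n + 1),
      (1 + (i : ℝ) • A x : V →L[ℝ] V).det *
        (Lagrange.basis (Finset.range (n + 1)) v i).eval t := by
    intro x
    obtain ⟨p, hp, hpe⟩ := exists_polynomial_det_one_add_smul (A x)
    have hv : Set.InjOn v (Finset.range (n + 1)) := fun i _ j _ h => Nat.cast_injective h
    have := Lagrange.eq_interpolate_of_eval_eq
      (fun i : ℕ => (1 + (i : ℝ) • A x : V →L[ℝ] V).det) hv (f := p)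
      (by
        rw [Finset.card_range]
        exact lt_of_le_of_lt degree_le_natDegree (by exact_mod_cast Nat.lt_succ_of_le hp))
      (fun i _ => hpe i)
    rw [← hpe t, this, Lagrange.interpolate_apply, eval_finsetSum]
    simp
  simp_rw [key]
  rw [integral_finsetSum _ fun (i : ℕ) _ => (hint (i : ℝ)).mul_const _, eval_finsetSum]
  simp [integral_mul_const]

/-- There is no `C¹` retraction of the closed unit ball onto the unit sphere. For a retraction `f`
and `F t x = x + t • (f x - x)`, the integral of `det (F t)'` over the ball is a polynomial in `t`.
For small `t > 0` it is the volume of the ball, as `F t` maps the ball bijectively onto itself;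
but for `t = 1` it vanishes, since `F 1 = f` takes values in the sphere. -/
theorem not_contDiffOn_retraction_sphere {f : V → V} {U : Set V} (hU : IsOpen U)
    (hBU : closedBall (0 : V) 1 ⊆ U) (hf : ContDiffOn ℝ 1 f U)
    (hmap : ∀ x ∈ closedBall (0 : V) 1, ‖f x‖ = 1) (hid : ∀ x, ‖x‖ = 1 → f x = x) : False := by
  set g : V → V := fun x => f x - x with hgdef
  have hg : ContDiffOn ℝ 1 g U := hf.sub contDiffOn_id
  set A : V → V →L[ℝ] V := fderiv ℝ g with hAdef
  have hAc : ContinuousOn A (closedBall 0 1) :=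
    (hg.continuousOn_fderiv_of_isOpen hU le_rfl).mono hBU
  have hgs : ∀ x ∈ closedBall (0 : V) 1, HasStrictFDerivAt g (A x) x := fun x hx =>
    (hg.contDiffAt (hU.mem_nhds (hBU hx))).hasStrictFDerivAt one_ne_zero
  obtain ⟨C, hC⟩ := (isCompact_closedBall (0 : V) 1).exists_bound_of_continuousOn hAc
  have hC0 : 0 ≤ C := (norm_nonneg _).trans (hC 0 (by simp))
  have hlip : ∀ x ∈ closedBall (0 : V) 1, ∀ y ∈ closedBall (0 : V) 1,
      ‖g y - g x‖ ≤ C * ‖y - x‖ := fun x hx y hy =>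
    (convex_closedBall (0 : V) 1).norm_image_sub_le_of_norm_hasFDerivWithin_le
      (fun z hz => (hgs z hz).hasFDerivAt.hasFDerivWithinAt) hC hx hy
  obtain ⟨η, hη, hdetpos⟩ : ∃ η > 0, ∀ B : V →L[ℝ] V, ‖B‖ < η → 0 < (1 + B).det := by
    have hcont : Continuous fun B : V →L[ℝ] V => (1 + B).det :=
      ContinuousLinearMap.continuous_det.comp (continuous_const.add continuous_id)
    have h0 : (0 : ℝ) < ((1 : V →L[ℝ] V) + 0).det := by
      simp [ContinuousLinearMap.det, ContinuousLinearMap.one_def]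
    obtain ⟨η, hη, h⟩ := Metric.mem_nhds_iff.1 (hcont.continuousAt.eventually (lt_mem_nhds h0))
    exact ⟨η, hη, fun B hB => h (by simpa using hB)⟩
  have hF : ∀ t : ℝ, ∀ x ∈ closedBall (0 : V) 1,
      HasStrictFDerivAt (fun x => x + t • g x) (1 + t • A x) x := fun t x hx =>
    (hasStrictFDerivAt_id x).add ((hgs x hx).const_smul t)
  obtain ⟨P, hP⟩ := exists_polynomial_integral_det_one_add_smul (isCompact_closedBall (0 : V) 1)
    ball_subset_closedBall hAc
  -- for `t < τ` the map `x + t • g x` is injective and its derivative has positive determinant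
  set τ := min 1 (min η 1 / (C + 1)) with hτ
  have hτ0 : 0 < τ := by positivity
  have hsmall : ∀ t ∈ Set.Ioo 0 τ, P.eval t = volume.real (ball (0 : V) 1) := by
    rintro t ⟨ht0, htτ⟩
    have ht1 : t < 1 := htτ.trans_le (min_le_left _ _)
    have htC : t * (C + 1) < min η 1 := (lt_div_iff₀ (by positivity)).1
      (htτ.trans_le (min_le_right _ _))
    have htη : t * C < η := by nlinarith [min_le_left η 1]
    have htC1 : t * C < 1 := by nlinarith [min_le_right η 1]
    have hpos : ∀ x ∈ closedBall (0 : V) 1, 0 < (1 + t • A x).det := fun x hx => by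
      refine hdetpos _ (lt_of_le_of_lt ?_ htη)
      rw [norm_smul, Real.norm_of_nonneg ht0.le]
      exact mul_le_mul_of_nonneg_left (hC x hx) ht0.le
    have hinj : Set.InjOn (fun x => x + t • g x) (ball (0 : V) 1) := by
      intro x hx y hy hxy
      have h1 : y - x = - (t • (g y - g x)) := by
        simp only at hxy
        rw [smul_sub, neg_sub, sub_eq_sub_iff_add_eq_add, ← hxy, add_comm]
      have h2 : ‖y - x‖ ≤ t * C * ‖y - x‖ := by
        conv_lhs => rw [h1, norm_neg, norm_smul, Real.norm_of_nonneg ht0.le]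
        rw [mul_assoc]
        exact mul_le_mul_of_nonneg_left
          (hlip x (ball_subset_closedBall hx) y (ball_subset_closedBall hy)) ht0.le
      have h3 : ‖y - x‖ = 0 := by nlinarith [norm_nonneg (y - x)]
      exact (sub_eq_zero.1 (norm_eq_zero.1 h3)).symm
    have himg : (fun x => x + t • g x) '' ball (0 : V) 1 = ball 0 1 := by
      refine image_ball_eq_of_det_ne_zero (hF t) (fun x hx => (hpos x hx).ne') ?_ ?_
      · intro x hx
        have hx1 : ‖x‖ < 1 := by simpa using hx
        have h : x + t • g x = (1 - t) • x + t • f x := by simp only [hgdef]; module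
        rw [mem_ball_zero_iff]
        dsimp only
        rw [h]
        refine (norm_add_le _ _).trans_lt ?_
        rw [norm_smul, norm_smul, Real.norm_of_nonneg ht0.le, Real.norm_of_nonneg (by linarith),
          hmap x (ball_subset_closedBall hx)]
        nlinarith
      · intro x hx
        simp [hgdef, hid x hx]
    have hcov := integral_image_eq_integral_abs_det_fderiv_smul volume
      (measurableSet_ball (x := (0 : V)) (ε := 1))
      (fun x hx => (hF t x (ball_subset_closedBall hx)).hasFDerivAt.hasFDerivWithinAt) hinj
      (fun _ => (1 : ℝ))
    rw [himg] at hcov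
    rw [← hP t]
    simp only [smul_eq_mul, mul_one, integral_const, MeasurableSet.univ, measureReal_restrict_apply,
      Set.univ_inter] at hcov
    rw [hcov]
    exact setIntegral_congr_fun measurableSet_ball
      fun x hx => (abs_of_pos (hpos x (ball_subset_closedBall hx))).symm
  have hPconst : P = Polynomial.C (volume.real (ball (0 : V) 1)) :=
    Polynomial.eq_of_infinite_eval_eq _ _ ((Set.Ioo_infinite hτ0).mono fun t ht => by
      simpa using hsmall t ht)
  have hzero : ∫ x in ball (0 : V) 1, (1 + (1 : ℝ) • A x : V →L[ℝ] V).det = 0 := by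
    refine setIntegral_eq_zero_of_forall_eq_zero fun x hx => ?_
    by_contra hne
    have hx' := ball_subset_closedBall hx
    have hD : HasFDerivAt f (1 + (1 : ℝ) • A x) x := by
      have := (hF 1 x hx').hasFDerivAt
      refine this.congr_of_eventuallyEq (Eventually.of_forall fun y => ?_)
      simp [hgdef]
    have hsurj : Function.Surjective (1 + (1 : ℝ) • A x : V →L[ℝ] V) := by
      have := (LinearMap.isUnit_iff_isUnit_det ((1 + (1 : ℝ) • A x : V →L[ℝ] V) : V →ₗ[ℝ] V)).2
        (isUnit_iff_ne_zero.2 hne)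
      exact LinearMap.range_eq_top.1 ((LinearMap.isUnit_iff_range_eq_top _).1 this)
    -- `‖f y‖ ^ 2` is constant near `x`, so its derivative `h ↦ 2 ⟪f x, f' x h⟫` vanishes.
    have h1 := hD.norm_sq
    have h2 : HasFDerivAt (fun y => ‖f y‖ ^ 2) (0 : V →L[ℝ] ℝ) x := by
      refine (hasFDerivAt_const (1 : ℝ) x).congr_of_eventuallyEq ?_
      filter_upwards [isOpen_ball.mem_nhds hx] with y hy
      rw [hmap y (ball_subset_closedBall hy), one_pow]
    obtain ⟨h, hh⟩ := hsurj (f x)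
    have h3 := congrArg (fun L : V →L[ℝ] ℝ => L h) (h1.unique h2)
    simp only [FunLike.coe_smul, Pi.smul_apply, ContinuousLinearMap.comp_apply, hh,
      innerSL_apply_apply, real_inner_self_eq_norm_sq, hmap x hx',
      zero_apply] at h3
    norm_num at h3
  rw [hP 1, hPconst, eval_C] at hzero
  exact (ENNReal.toReal_pos (measure_ball_pos volume (0 : V) one_pos).ne'
    measure_ball_lt_top.ne).ne' hzero

end Brouwer

/-! ### Brouwer's fixed point theorem -/

section BrouwerContinuous

open Metric MeasureTheory
open scoped RealInnerProductSpace

variable {V : Type*} [NormedAddCommGroup V] [InnerProductSpace ℝ V] [FiniteDimensional ℝ V]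

/-- Brouwer's theorem for `C¹` maps. If `f` had no fixed point, the point where the ray from `f x`
through `x` leaves the ball would define a `C¹` retraction onto the sphere. -/
theorem exists_fixedPoint_of_contDiff {f : V → V} (hf : ContDiff ℝ 1 f)
    (hmap : ∀ x, ‖x‖ ≤ 1 → ‖f x‖ ≤ 1) : ∃ x, ‖x‖ ≤ 1 ∧ f x = x := by
  by_contra! hne
  borelize V
  set u : V → V := fun x => x - f x with hu
  have hus : ContDiff ℝ 1 u := contDiff_id.sub hf
  set d : V → ℝ := fun x => ⟪x, u x⟫ ^ 2 + ‖u x‖ ^ 2 * (1 - ‖x‖ ^ 2) with hd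
  have hds : ContDiff ℝ 1 d :=
    ((contDiff_id.inner ℝ hus).pow 2).add ((hus.norm_sq ℝ).mul
      (contDiff_const.sub (contDiff_id.norm_sq ℝ)))
  -- `‖x + c • u x‖ = 1` is a quadratic equation in `c` with discriminant `4 * d x`; `ρ x` uses its
  -- larger root, which is `0` on the sphere because there `0 < ⟪x, u x⟫`.
  set ρ : V → V := fun x => x + ((-⟪x, u x⟫ + √(d x)) / ‖u x‖ ^ 2) • u x with hρ
  have hu0 : ∀ x, ‖x‖ ≤ 1 → u x ≠ 0 := fun x hx h => hne x hx (sub_eq_zero.1 h).symm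
  have hpos : ∀ x, ‖x‖ = 1 → 0 < ⟪x, u x⟫ := by
    intro x hx
    have h1 : 0 < ‖u x‖ ^ 2 := by have := norm_pos_iff.2 (hu0 x hx.le); positivity
    have h2 : ‖u x‖ ^ 2 = ‖x‖ ^ 2 - 2 * ⟪x, f x⟫ + ‖f x‖ ^ 2 := norm_sub_sq_real x (f x)
    have h3 : ⟪x, u x⟫ = ‖x‖ ^ 2 - ⟪x, f x⟫ := by
      rw [hu]; simp only [inner_sub_right, real_inner_self_eq_norm_sq]
    have h4 : ‖f x‖ ^ 2 ≤ 1 := by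
      have := hmap x hx.le
      nlinarith [norm_nonneg (f x)]
    rw [hx] at h2 h3
    linarith
  have hdpos : ∀ x, ‖x‖ ≤ 1 → 0 < d x := by
    intro x hx
    have h1 : 0 < ‖u x‖ := norm_pos_iff.2 (hu0 x hx)
    rcases hx.lt_or_eq with h | h
    · have : 0 < 1 - ‖x‖ ^ 2 := by nlinarith [norm_nonneg x]
      simp only [hd]; positivity
    · have := hpos x h
      simp only [hd, h]; norm_num; positivity
  refine not_contDiffOn_retraction_sphere (U := {x | u x ≠ 0 ∧ 0 < d x}) (f := ρ) ?_ ?_ ?_ ?_ ?_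
  · exact (isOpen_ne.preimage hus.continuous).inter (isOpen_lt continuous_const hds.continuous)
  · intro x hx
    rw [mem_closedBall_zero_iff] at hx
    exact ⟨hu0 x hx, hdpos x hx⟩
  · refine contDiffOn_id.add (ContDiffOn.smul (ContDiffOn.div ?_ ?_ ?_) hus.contDiffOn)
    · exact (contDiff_id.inner ℝ hus).neg.contDiffOn.add
        (hds.contDiffOn.sqrt fun x hx => hx.2.ne')
    · exact (hus.norm_sq ℝ).contDiffOn
    · exact fun x hx => pow_ne_zero 2 (norm_ne_zero_iff.2 hx.1)
  · intro x hx
    rw [mem_closedBall_zero_iff] at hx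
    have h1 : 0 < ‖u x‖ := norm_pos_iff.2 (hu0 x hx)
    have h2 := Real.sq_sqrt (hdpos x hx).le
    have h3 : ‖ρ x‖ ^ 2 = 1 := by
      simp only [hρ]
      rw [norm_add_sq_real, real_inner_smul_right, norm_smul, mul_pow, Real.norm_eq_abs, sq_abs]
      field_simp
      have h4 : d x = ⟪x, u x⟫ ^ 2 + ‖u x‖ ^ 2 * (1 - ‖x‖ ^ 2) := rfl
      linear_combination h2 + h4
    exact (pow_eq_one_iff_of_nonneg (norm_nonneg _) two_ne_zero).1 h3
  · intro x hx
    have h1 : √(d x) = ⟪x, u x⟫ := by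
      rw [show d x = ⟪x, u x⟫ ^ 2 by simp [hd, hx], Real.sqrt_sq (hpos x hx).le]
    simp [hρ, h1]

/-- Brouwer's theorem for maps that are continuous on the whole space, by approximation with smooth
maps: the minimum of `‖f x - x‖` over the ball cannot be positive. -/
theorem exists_fixedPoint_of_continuous {f : V → V} (hf : Continuous f)
    (hmap : ∀ x, ‖x‖ ≤ 1 → ‖f x‖ ≤ 1) : ∃ x, ‖x‖ ≤ 1 ∧ f x = x := by
  obtain ⟨x₀, hx₀, hmin⟩ := (isCompact_closedBall (0 : V) 1).exists_isMinOn
    ⟨0, by simp⟩ (hf.sub continuous_id).norm.continuousOn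
  by_contra! hne
  have hpos : 0 < ‖f x₀ - x₀‖ :=
    norm_pos_iff.2 (sub_ne_zero.2 (hne x₀ (mem_closedBall_zero_iff.1 hx₀)))
  set ε := ‖f x₀ - x₀‖ / 2 with hε
  have hε0 : 0 < ε := by positivity
  obtain ⟨p, hp, hpf, -⟩ := hf.exists_contDiff_approx 1 (ε := fun _ => ε) continuous_const
    fun _ => hε0
  -- `p` maps the unit ball into the ball of radius `1 + ε`, so it is rescaled first.
  obtain ⟨x, hx, hfx⟩ := exists_fixedPoint_of_contDiff (f := fun x => (1 + ε)⁻¹ • p x)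
    (hp.const_smul _) (fun x hx => by
      have h1 : ‖p x‖ ≤ 1 + ε := by
        have := norm_add_le (f x) (p x - f x)
        rw [add_sub_cancel, ← dist_eq_norm] at this
        linarith [hpf x, hmap x hx]
      rw [norm_smul, norm_inv, Real.norm_of_nonneg (by positivity)]
      exact (inv_mul_le_one₀ (by positivity)).2 h1)
  have h2 : p x = (1 + ε) • x := by
    rw [← hfx, smul_smul, mul_inv_cancel₀ (by positivity), one_smul, hfx]
  have h3 : ‖f x - x‖ < 2 * ε := by
    have h4 : f x - x = (f x - p x) + ε • x := by rw [h2]; module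
    rw [h4]
    refine (norm_add_le _ _).trans_lt ?_
    rw [norm_smul, Real.norm_of_nonneg hε0.le, ← dist_eq_norm, dist_comm]
    nlinarith [hpf x]
  have h5 : ‖f x₀ - x₀‖ ≤ ‖f x - x‖ := hmin (mem_closedBall_zero_iff.2 hx)
  linarith

/-- A continuous retraction of `ι → ℝ` onto the standard simplex: truncate the coordinates at `0`,
then either spread the missing mass evenly or normalise. -/
noncomputable def simplexRetraction {ι : Type*} [Fintype ι] (x : ι → ℝ) : ι → ℝ := fun i =>
  (max (x i) 0 + max (1 - ∑ j, max (x j) 0) 0 / Fintype.card ι) / max (∑ j, max (x j) 0) 1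

lemma continuous_simplexRetraction {ι : Type*} [Fintype ι] :
    Continuous (simplexRetraction (ι := ι)) := by
  refine continuous_pi fun i => Continuous.div (by fun_prop) (by fun_prop) fun x => ?_
  exact (lt_max_of_lt_right one_pos).ne'

lemma simplexRetraction_mem {ι : Type*} [Fintype ι] [Nonempty ι] (x : ι → ℝ) :
    simplexRetraction x ∈ stdSimplex ℝ ι := by
  refine ⟨fun i => by unfold simplexRetraction; positivity, ?_⟩
  simp only [simplexRetraction]
  rw [← Finset.sum_div, Finset.sum_add_distrib, Finset.sum_const, Finset.card_univ, nsmul_eq_mul,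
    mul_div_cancel₀ _ (by positivity)]
  set s := ∑ j, max (x j) 0
  rw [div_eq_one_iff_eq (lt_max_of_lt_right one_pos).ne']
  rcases le_total s 1 with h | h
  · rw [max_eq_left (by linarith), max_eq_right h]; ring
  · rw [max_eq_right (by linarith), max_eq_left h, add_zero]

lemma simplexRetraction_eq_self {ι : Type*} [Fintype ι] {x : ι → ℝ} (hx : x ∈ stdSimplex ℝ ι) :
    simplexRetraction x = x := by
  have h : ∀ i, max (x i) 0 = x i := fun i => max_eq_left (hx.1 i)
  funext i
  simp [simplexRetraction, h, hx.2]

/-- Brouwer's fixed point theorem on the standard simplex. -/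
theorem exists_fixedPoint_stdSimplex {ι : Type*} [Fintype ι] [Nonempty ι] {h : (ι → ℝ) → ι → ℝ}
    (hc : ContinuousOn h (stdSimplex ℝ ι))
    (hm : Set.MapsTo h (stdSimplex ℝ ι) (stdSimplex ℝ ι)) :
    ∃ x ∈ stdSimplex ℝ ι, h x = x := by
  have hcont : Continuous fun x : EuclideanSpace ℝ ι =>
      WithLp.toLp 2 (h (simplexRetraction x.ofLp)) :=
    (PiLp.continuous_toLp 2 _).comp (hc.comp_continuous
      (continuous_simplexRetraction.comp (PiLp.continuous_ofLp 2 _))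
      fun x => simplexRetraction_mem _)
  obtain ⟨x, -, hx⟩ := exists_fixedPoint_of_continuous hcont fun x _ => by
    have hy := hm (simplexRetraction_mem x.ofLp)
    set y := h (simplexRetraction x.ofLp)
    rw [← sq_le_one_iff₀ (norm_nonneg _), EuclideanSpace.norm_sq_eq, ← hy.2]
    refine Finset.sum_le_sum fun i _ => ?_
    have h1 : y i ≤ 1 := hy.2 ▸ Finset.single_le_sum (fun j _ => hy.1 j) (Finset.mem_univ i)
    have h0 := hy.1 i
    simp only [Real.norm_eq_abs, sq_abs]
    nlinarith
  have hx' : h (simplexRetraction x.ofLp) = x.ofLp := congrArg WithLp.ofLp hx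
  have hmem : x.ofLp ∈ stdSimplex ℝ ι := hx' ▸ hm (simplexRetraction_mem _)
  exact ⟨x.ofLp, hmem, by rwa [simplexRetraction_eq_self hmem] at hx'⟩

end BrouwerContinuous

/-! ### Approximate fixed points with respect to finitely many functionals -/

section ApproximateFixedPoints

variable {𝕜 E : Type*} [RCLike 𝕜] [NormedAddCommGroup E] [NormedSpace 𝕜 E] [NormedSpace ℝ E]
  [IsScalarTower ℝ 𝕜 E]

/-- Schauder's construction: `K` is covered by finitely many balls for the seminorm
`max i, ‖φ i ·‖`, and composing `g` with the corresponding projection to the convex hull of the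
centres gives a continuous self-map of a simplex. Only the functions `φ i ∘ g` need be continuous. -/
theorem exists_approx_fixedPoint {K : Set E} (hK : Convex ℝ K) (hne : K.Nonempty)
    (hb : Bornology.IsBounded K) {g : E → E} (hg : Set.MapsTo g K K) {ι : Type*} [Fintype ι]
    (φ : ι → StrongDual 𝕜 E) (hcont : ∀ i, ContinuousOn (fun v => φ i (g v)) K) {ε : ℝ}
    (hε : 0 < ε) : ∃ v ∈ K, ∀ i, ‖φ i (g v) - φ i v‖ ≤ ε := by
  classical
  set T : E →L[𝕜] (ι → 𝕜) := ContinuousLinearMap.pi φ with hT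
  have hTb : TotallyBounded (T '' K) :=
    (T.lipschitz.isBounded_image hb).isCompact_closure.totallyBounded.subset subset_closure
  obtain ⟨c, hcK, hcf, hcov⟩ := Metric.finite_approx_of_totallyBounded hTb ε hε
  have : Fintype c := hcf.fintype
  choose x hxK hx using fun j : c => hcK j.2
  have hcne : Nonempty c := by
    obtain ⟨v, hv⟩ := hne
    obtain ⟨y, hy, -⟩ := Set.mem_iUnion₂.1 (hcov (Set.mem_image_of_mem T hv))
    exact ⟨⟨y, hy⟩⟩
  set σ : (c → ℝ) → E := fun t => ∑ j, t j • x j with hσ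
  have hσc : Continuous σ := by fun_prop
  have hσK : Set.MapsTo σ (stdSimplex ℝ c) K := fun t ht =>
    hK.sum_mem (fun j _ => ht.1 j) ht.2 fun j _ => hxK j
  set w : (ι → 𝕜) → c → ℝ := fun y j => max (ε - ‖y - j‖) 0 with hw
  have hwc : ∀ j, Continuous fun y => w y j := fun j => by fun_prop
  have hwpos : ∀ v ∈ K, 0 < ∑ j, w (T v) j := by
    intro v hv
    obtain ⟨y, hy, hvy⟩ := Set.mem_iUnion₂.1 (hcov (Set.mem_image_of_mem T hv))
    refine Finset.sum_pos' (fun j _ => le_max_right _ _) ⟨⟨y, hy⟩, Finset.mem_univ _, ?_⟩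
    rw [mem_ball_iff_norm] at hvy
    exact lt_max_of_lt_left (by simpa using hvy)
  set h : (c → ℝ) → c → ℝ := fun t j => w (T (g (σ t))) j / ∑ k, w (T (g (σ t))) k with hh
  have hTg : ContinuousOn (fun t => T (g (σ t))) (stdSimplex ℝ c) := by
    refine continuousOn_pi.2 fun i => ?_
    exact (hcont i).comp hσc.continuousOn hσK
  have hhc : ContinuousOn h (stdSimplex ℝ c) := by
    refine continuousOn_pi.2 fun j => ContinuousOn.div ((hwc j).comp_continuousOn hTg)
      ((continuous_finsetSum _ fun k _ => hwc k).comp_continuousOn hTg) fun t ht => ?_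
    exact (hwpos _ (hg (hσK ht))).ne'
  have hhm : Set.MapsTo h (stdSimplex ℝ c) (stdSimplex ℝ c) := by
    intro t ht
    have hpos := hwpos _ (hg (hσK ht))
    refine ⟨fun j => div_nonneg (le_max_right _ _) hpos.le, ?_⟩
    simp only [hh]
    rw [← Finset.sum_div, div_self hpos.ne']
  obtain ⟨t, ht, hfix⟩ := exists_fixedPoint_stdSimplex hhc hhm
  refine ⟨σ t, hσK ht, fun i => ?_⟩
  have h1 : T (g (σ t)) - T (σ t) = ∑ j, t j • (T (g (σ t)) - (j : ι → 𝕜)) := by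
    simp_rw [smul_sub, Finset.sum_sub_distrib, ← Finset.sum_smul, ht.2, one_smul]
    congr 1
    simp only [hσ, map_sum]
    refine Finset.sum_congr rfl fun j _ => ?_
    rw [← hx j]
    exact (T.restrictScalars ℝ).map_smul (t j) (x j)
  have h2 : ‖T (g (σ t)) - T (σ t)‖ ≤ ε := by
    rw [h1]
    calc _ ≤ ∑ j, t j * ε := ?_
      _ = ε := by rw [← Finset.sum_mul, ht.2, one_mul]
    refine norm_sum_le_of_le _ fun j _ => ?_
    rw [norm_smul, Real.norm_of_nonneg (ht.1 j)]
    by_cases hj : ‖T (g (σ t)) - (j : ι → 𝕜)‖ ≤ ε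
    · exact mul_le_mul_of_nonneg_left hj (ht.1 j)
    · have : t j = 0 := by
        rw [← hfix]
        simp only [hh, hw]
        rw [max_eq_right (by linarith), zero_div]
      simp [this]
  exact (norm_le_pi_norm (T (g (σ t)) - T (σ t)) i).trans h2

end ApproximateFixedPoints

/-! ### Separable invariant subspaces -/

section SeparableReduction

lemma exists_countable_closed_under {α ι : Type*} [Countable ι] (f : ι → α → α → α) {S : Set α}
    (hS : S.Countable) :
    ∃ D : Set α, D.Countable ∧ S ⊆ D ∧ ∀ i, ∀ x ∈ D, ∀ y ∈ D, f i x y ∈ D := by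
  let step : Set α → Set α := fun A => A ∪ ⋃ i, Set.image2 (f i) A A
  have hmono : Monotone fun n => step^[n] S :=
    monotone_nat_of_le_succ fun n => by
      rw [Function.iterate_succ_apply']
      exact Set.subset_union_left
  refine ⟨⋃ n, step^[n] S, Set.countable_iUnion fun n => ?_, Set.subset_iUnion_of_subset 0 le_rfl,
    ?_⟩
  · induction n with
    | zero => exact hS
    | succ n ih =>
      rw [Function.iterate_succ_apply']
      exact ih.union (Set.countable_iUnion fun i => ih.image2 ih _)
  · intro i x hx y hy
    obtain ⟨m, hm⟩ := Set.mem_iUnion.1 hx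
    obtain ⟨n, hn⟩ := Set.mem_iUnion.1 hy
    refine Set.mem_iUnion.2 ⟨max m n + 1, ?_⟩
    rw [Function.iterate_succ_apply']
    exact Or.inr (Set.mem_iUnion.2 ⟨i, Set.mem_image2_of_mem (hmono (le_max_left _ _) hm)
      (hmono (le_max_right _ _) hn)⟩)

variable (𝕜 : Type*) {E : Type*} [RCLike 𝕜] [NormedAddCommGroup E] [NormedSpace 𝕜 E]

/-- The closure of a countable set that is stable under `g`, addition and multiplication by a dense
set of scalars is a submodule. Where `g` is weakly sequentially continuous, it then maps this
submodule into itself. -/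
lemma exists_submodule_eq_closure_countable (g : E → E) :
    ∃ (F : Submodule 𝕜 E) (D : Set E), D.Countable ∧ (F : Set E) = closure D ∧ 0 ∈ D ∧
      Set.MapsTo g D D := by
  obtain ⟨Q, hQc, hQd⟩ := TopologicalSpace.exists_countable_dense 𝕜
  have : Countable Q := hQc.to_subtype
  -- the operations are `g`, addition, and multiplication by the scalars in `Q`
  obtain ⟨D, hDc, hSD, hD⟩ := exists_countable_closed_under
    (fun (i : Option (Option Q)) (x y : E) =>
      i.elim (g x) fun j => j.elim (x + y) fun q => (q : 𝕜) • x)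
    (S := {0}) (by simp)
  refine ⟨{ carrier := closure D
            zero_mem' := subset_closure (hSD (by simp))
            add_mem' := fun hx hy =>
              map_mem_closure₂ continuous_add hx hy fun x hx y hy => hD (some none) x hx y hy
            smul_mem' := fun a x hx =>
              map_mem_closure₂ continuous_smul (hQd a) hx
                fun q hq y hy => hD (some (some ⟨q, hq⟩)) y hy y hy },
    D, hDc, rfl, hSD (by simp), fun x hx => hD none x hx x hx⟩

end SeparableReduction

/-! ### Weak convergence in reflexive spaces -/

section WeakTopology

variable {𝕜 E : Type*} [RCLike 𝕜] [NormedAddCommGroup E] [NormedSpace 𝕜 E]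

lemma weaklyTendsto_iff {u : ℕ → E} {a : E} :
    WeaklyTendsto 𝕜 u a ↔ ∀ φ : StrongDual 𝕜 E, Tendsto (fun n => φ (u n)) atTop (𝓝 (φ a)) := by
  refine WeakBilin.tendsto_iff_forall_eval_tendsto (topDualPairing 𝕜 E).flip ?_
  intro x y hxy
  by_contra hne
  obtain ⟨φ, hφ⟩ := SeparatingDual.exists_separating_of_ne (R := 𝕜) hne
  exact hφ (LinearMap.congr_fun hxy φ)

lemma exists_dual_vanishing_of_notMem {F : Submodule 𝕜 E} (hF : IsClosed (F : Set E)) {a : E}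
    (ha : a ∉ F) : ∃ ψ : StrongDual 𝕜 E, (∀ x ∈ F, ψ x = 0) ∧ ψ a ≠ 0 := by
  have : IsClosed (F : Set E) := hF
  have hne : (F.mkQ a) ≠ 0 := by simpa using ha
  obtain ⟨ψ, hψ⟩ := SeparatingDual.exists_ne_zero (R := 𝕜) hne
  refine ⟨ψ.comp F.mkQL, fun x hx => ?_, hψ⟩
  have : F.mkQL x = 0 := (Submodule.Quotient.mk_eq_zero F).2 hx
  simp [this]

lemma WeaklyTendsto.mem_of_isClosed {F : Submodule 𝕜 E} (hF : IsClosed (F : Set E)) {u : ℕ → E}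
    {a : E} (h : WeaklyTendsto 𝕜 u a) (hu : ∀ n, u n ∈ F) : a ∈ F := by
  by_contra ha
  obtain ⟨ψ, hψF, hψa⟩ := exists_dual_vanishing_of_notMem hF ha
  refine hψa (tendsto_nhds_unique (weaklyTendsto_iff.1 h ψ) ?_)
  simp [hψF _ (hu _)]

/-- Norming functionals of a countable dense set separate points. -/
lemma exists_seq_dual_separating {D : Set E} (hD : D.Countable) (hne : D.Nonempty) :
    ∃ φ : ℕ → StrongDual 𝕜 E, ∀ v ∈ closure D, (∀ i, φ i v = 0) → v = 0 := by
  obtain ⟨d, rfl⟩ := hD.exists_eq_range hne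
  choose φ hφ hφd using fun i => exists_dual_vector'' 𝕜 (d i)
  refine ⟨φ, fun v hv hv0 => norm_le_zero_iff.1 (le_of_forall_pos_le_add fun ε hε => ?_)⟩
  obtain ⟨_, ⟨i, rfl⟩, hi⟩ := Metric.mem_closure_iff.1 hv (ε / 2) (half_pos hε)
  have h1 : ‖d i‖ ≤ ‖d i - v‖ := by
    have h2 : φ i (d i - v) = (‖d i‖ : 𝕜) := by rw [map_sub, hφd, hv0, sub_zero]
    have h3 := (φ i).le_of_opNorm_le (hφ i) (d i - v)
    rwa [h2, RCLike.norm_ofReal, abs_norm, one_mul] at h3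
  have h4 := norm_sub_norm_le v (d i)
  rw [dist_eq_norm] at hi
  rw [norm_sub_rev] at h1
  linarith

/-- By reflexivity and the Banach-Alaoglu theorem applied in the bidual, the closed
balls of `F` are weakly compact; on them, countably many separating functionals make the weak
topology metrizable. -/
lemma exists_subseq_weaklyTendsto (hE : IsReflexiveSpace 𝕜 E) {F : Submodule 𝕜 E}
    (hF : IsClosed (F : Set E)) {φ : ℕ → StrongDual 𝕜 E}
    (hφ : ∀ v ∈ F, (∀ i, φ i v = 0) → v = 0) {ρ : ℝ} {v : ℕ → E} (hvF : ∀ n, v n ∈ F)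
    (hvρ : ∀ n, ‖v n‖ ≤ ρ) :
    ∃ a ∈ F, ‖a‖ ≤ ρ ∧ ∃ s : ℕ → ℕ, StrictMono s ∧ WeaklyTendsto 𝕜 (v ∘ s) a := by
  set S : Set (WeakDual 𝕜 (StrongDual 𝕜 E)) :=
    (WeakDual.toStrongDual ⁻¹' Metric.closedBall 0 ρ) ∩
      {ξ | ∀ ψ : StrongDual 𝕜 E, (∀ x ∈ F, ψ x = 0) → ξ ψ = 0} with hS
  have hS_cpt : IsCompact S := by
    refine (WeakDual.isCompact_closedBall 0 ρ).inter_right ?_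
    simp only [Set.ofPred_forall]
    exact isClosed_iInter fun ψ => isClosed_iInter fun _ =>
      isClosed_eq (WeakDual.eval_continuous ψ) continuous_const
  have hrep : ∀ ξ ∈ S, ∃ a ∈ F, ‖a‖ ≤ ρ ∧ ∀ ψ : StrongDual 𝕜 E, ξ ψ = ψ a := by
    rintro ξ ⟨hξ, hξF⟩
    obtain ⟨a, ha⟩ := hE (WeakDual.toStrongDual ξ)
    have hap : ∀ ψ : StrongDual 𝕜 E, ξ ψ = ψ a := fun ψ => (DFunLike.congr_fun ha ψ).symm
    refine ⟨a, ?_, ?_, hap⟩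
    · by_contra haF
      obtain ⟨ψ, hψF, hψa⟩ := exists_dual_vanishing_of_notMem hF haF
      exact hψa ((hap ψ).symm.trans (hξF ψ hψF))
    · rw [← (NormedSpace.inclusionInDoubleDualLi 𝕜).norm_map a]
      have : (NormedSpace.inclusionInDoubleDualLi 𝕜) a = WeakDual.toStrongDual ξ := ha
      rw [this]
      exact (mem_closedBall_zero_iff (E := StrongDual 𝕜 (StrongDual 𝕜 E))).1 hξ
  have : CompactSpace S := isCompact_iff_compactSpace.1 hS_cpt
  have : TopologicalSpace.MetrizableSpace S := by
    refine Metric.PiNatEmbed.TopologicalSpace.MetrizableSpace.of_countable_separating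
      (fun (i : ℕ) (ξ : S) => ξ.1 (φ i))
      (fun i => (WeakDual.eval_continuous (φ i)).comp continuous_subtype_val) fun ξ ζ hne => ?_
    by_contra! heq
    obtain ⟨a, haF, -, ha⟩ := hrep ξ ξ.2
    obtain ⟨b, hbF, -, hb⟩ := hrep ζ ζ.2
    have hab : a - b = 0 := hφ _ (F.sub_mem haF hbF) fun i => by
      rw [map_sub, ← ha, ← hb, heq, sub_self]
    refine hne (Subtype.ext (DFunLike.ext _ _ fun ψ => ?_))
    rw [ha, hb, sub_eq_zero.1 hab]
  let ξ : ℕ → S := fun n => ⟨StrongDual.toWeakDual (NormedSpace.inclusionInDoubleDual 𝕜 E (v n)), by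
    refine ⟨?_, fun ψ hψ => hψ _ (hvF n)⟩
    have := (NormedSpace.inclusionInDoubleDualLi 𝕜).norm_map (v n)
    exact (mem_closedBall_zero_iff (E := StrongDual 𝕜 (StrongDual 𝕜 E))).2
      (this.le.trans (hvρ n))⟩
  obtain ⟨ζ, s, hs, hlim⟩ := CompactSpace.tendsto_subseq ξ
  obtain ⟨a, haF, haρ, ha⟩ := hrep ζ ζ.2
  refine ⟨a, haF, haρ, s, hs, weaklyTendsto_iff.2 fun ψ => ?_⟩
  rw [← ha ψ]
  exact (((WeakDual.eval_continuous ψ).comp continuous_subtype_val).tendsto ζ).comp hlim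

end WeakTopology

/-! ### Fixed points of weakly sequentially continuous maps -/

section FixedPoint

variable {𝕜 E : Type*} [RCLike 𝕜] [NormedAddCommGroup E] [NormedSpace 𝕜 E]

lemma WeaklySeqContinuousOn.continuousOn_dual {g : E → E} {s : Set E}
    (hg : WeaklySeqContinuousOn 𝕜 g s) (φ : StrongDual 𝕜 E) :
    ContinuousOn (fun v => φ (g v)) s := by
  rw [continuousOn_iff_continuous_domRestrict, continuous_iff_seqContinuous]
  intro u a hu
  refine weaklyTendsto_iff.1 (hg (fun n => u n) a (fun n => (u n).2) a.2
    (weaklyTendsto_iff.2 fun ψ => ?_)) φ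
  exact (ψ.continuous.tendsto _).comp ((continuous_subtype_val.tendsto a).comp hu)

/-- In a reflexive space, a weakly sequentially continuous self-map of a closed ball has a fixed
point. The argument takes place in a separable closed subspace `F` invariant under the map, on which
countably many functionals separate points; a weak limit of points that are approximately fixed for
more and more of them is fixed. -/
theorem exists_fixedPoint_of_weaklySeqContinuousOn (hE : IsReflexiveSpace 𝕜 E) {g : E → E}
    {r ρ : ℝ} (hρ : 0 ≤ ρ) (hρr : ρ < r) (hg : WeaklySeqContinuousOn 𝕜 g (Metric.ball 0 r))
    (hmap : ∀ v, ‖v‖ ≤ ρ → ‖g v‖ ≤ ρ) : ∃ v, ‖v‖ ≤ ρ ∧ g v = v := by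
  let _ : NormedSpace ℝ E := NormedSpace.restrictScalars ℝ 𝕜 E
  have : IsScalarTower ℝ 𝕜 E := .of_algebraMap_smul fun _ _ => rfl
  obtain ⟨F, D, hDc, hFD, h0D, hgD⟩ := exists_submodule_eq_closure_countable 𝕜 g
  have hFc : IsClosed (F : Set E) := hFD ▸ isClosed_closure
  have hDF : D ⊆ F := hFD ▸ subset_closure
  obtain ⟨φ, hφ⟩ := exists_seq_dual_separating (𝕜 := 𝕜) hDc ⟨0, h0D⟩
  replace hφ : ∀ v ∈ F, (∀ i, φ i v = 0) → v = 0 := fun v hv => hφ v (hFD ▸ hv)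
  have hKr : Metric.closedBall (0 : E) ρ ⊆ Metric.ball 0 r := Metric.closedBall_subset_ball hρr
  have hgF : ∀ v ∈ F, ‖v‖ ≤ ρ → g v ∈ F := by
    intro v hv hvρ
    have hvr : v ∈ Metric.ball (0 : E) r := hKr (by simpa using hvρ)
    have hcl : v ∈ closure (Metric.ball 0 r ∩ D) :=
      Metric.isOpen_ball.inter_closure ⟨hvr, by rw [← hFD]; exact hv⟩
    obtain ⟨u, hu, huv⟩ := mem_closure_iff_seq_limit.1 hcl
    refine (hg u v (fun n => (hu n).1) hvr (weaklyTendsto_iff.2 fun ψ =>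
      (ψ.continuous.tendsto v).comp huv)).mem_of_isClosed hFc fun n => hDF (hgD (hu n).2)
  set K : Set E := (F : Set E) ∩ Metric.closedBall 0 ρ with hK
  have hKconv : Convex ℝ K :=
    (F.restrictScalars ℝ).convex.inter (convex_closedBall 0 ρ)
  have hgK : Set.MapsTo g K K := fun v hv => by
    have hv2 := mem_closedBall_zero_iff.1 hv.2
    exact ⟨hgF v hv.1 hv2, mem_closedBall_zero_iff.2 (hmap v hv2)⟩
  have happrox : ∀ n : ℕ, ∃ v ∈ K, ∀ i : Fin (n + 1), ‖φ i (g v) - φ i v‖ ≤ 1 / ((n : ℝ) + 1) :=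
    fun n => exists_approx_fixedPoint hKconv ⟨0, F.zero_mem, by simpa using hρ⟩
      (Metric.isBounded_closedBall.subset Set.inter_subset_right) hgK (fun i : Fin (n + 1) => φ i)
      (fun i => (hg.continuousOn_dual (φ i)).mono (Set.inter_subset_right.trans hKr))
      Nat.one_div_pos_of_nat
  choose v hvK hv using happrox
  have hvρ : ∀ n, ‖v n‖ ≤ ρ := fun n => mem_closedBall_zero_iff.1 (hvK n).2
  obtain ⟨a, haF, haρ, s, hs, hlim⟩ :=
    exists_subseq_weaklyTendsto hE hFc hφ (fun n => (hvK n).1) hvρ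
  have hglim := hg (v ∘ s) a (fun n => hKr (hvK _).2) (hKr (by simpa using haρ)) hlim
  refine ⟨a, haρ, sub_eq_zero.1 (hφ _ (F.sub_mem (hgF a haF haρ) haF) fun i => ?_)⟩
  have h1 : Tendsto (fun n => φ i (g (v (s n))) - φ i (v (s n))) atTop (𝓝 (φ i (g a - a))) := by
    rw [map_sub]
    exact (weaklyTendsto_iff.1 hglim (φ i)).sub (weaklyTendsto_iff.1 hlim (φ i))
  refine tendsto_nhds_unique h1 (squeeze_zero_norm' ?_
    (tendsto_one_div_add_atTop_nhds_zero_nat.comp hs.tendsto_atTop))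
  filter_upwards [eventually_ge_atTop i] with n hn
  exact hv (s n) ⟨i, Nat.lt_succ_of_le (hn.trans (hs.id_le n))⟩

end FixedPoint

/-! ### Local surjectivity -/

theorem lemma2p2 {𝕜 E : Type*} [RCLike 𝕜] [NormedAddCommGroup E] [NormedSpace 𝕜 E]
    [CompleteSpace E] (hE : IsReflexiveSpace 𝕜 E)
    (r : ℝ) (hr : 0 < r) (Φ : E → E)
    (ha1 : (fun v : E => Φ v - v) =o[𝓝 0] (fun v : E => v))
    (ha2 : WeaklySeqContinuousOn 𝕜 Φ (Metric.ball 0 r)) :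
    ∃ δ : ℝ, 0 < δ ∧ Metric.ball (0 : E) δ ⊆ Φ '' Metric.ball (0 : E) r := by
  obtain ⟨ε, hε, hΦ⟩ := Metric.eventually_nhds_iff.1 (ha1.def (by norm_num : (0 : ℝ) < 1 / 2))
  set ρ := min ε r / 2 with hρ
  have hρ0 : 0 < ρ := by positivity
  have hρε : ρ < ε := by have := min_le_left ε r; linarith
  have hρr : ρ < r := by have := min_le_right ε r; linarith
  refine ⟨ρ / 2, by positivity, fun w hw => ?_⟩
  rw [mem_ball_zero_iff] at hw
  -- a fixed point of `v ↦ v - Φ v + w` is a solution of `Φ v = w`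
  have hg : WeaklySeqContinuousOn 𝕜 (fun v => v - Φ v + w) (Metric.ball 0 r) := by
    intro u a hu ha hua
    have h1 := weaklyTendsto_iff.1 (ha2 u a hu ha hua)
    refine weaklyTendsto_iff.2 fun φ => ?_
    simpa using ((weaklyTendsto_iff.1 hua φ).sub (h1 φ)).add_const (φ w)
  obtain ⟨v, hv, hfix⟩ := exists_fixedPoint_of_weaklySeqContinuousOn hE hρ0.le hρr hg fun v hv => by
    have h1 := hΦ (y := v) (by rw [dist_zero_right]; linarith)
    rw [norm_sub_rev] at h1
    linarith [norm_add_le (v - Φ v) w]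
  refine ⟨v, by rw [mem_ball_zero_iff]; linarith, ?_⟩
  have h2 : v - Φ v + w - v = 0 := sub_eq_zero.2 hfix
  have h3 : w - Φ v = 0 := by rw [← h2]; abel
  exact (sub_eq_zero.1 h3).symm
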